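/- Let $\mathcal{S}$ be the class of functions $f$ that are analytic and univalent in the unit disc $\mathbb{D}=\{z\in\mathbb{C}:|z|<1\}$ and have there the expansion $f(z)=z+a_2z^2+a_3z^3+\cdots$. Let $M$ be the maximum of $$\varphi_2(x,y,z,t)=x^4+3y^2+6x^2y+4xz+2t$$ over the set $\Omega$ of all $(x,y,z,t)\in\mathbb{R}^4$ with $$0\le x\le 1,\quad 0\le y\le \tfrac{1}{\sqrt3}\sqrt{1-x^2},\quad 0\le z\le \tfrac1{\sqrt5}\sqrt{1-x^2-3y^2},\quad 0\le t\le \tfrac1{\sqrt7}\sqrt{1-x^2-3y^2-5z^2}.$$ This maximum exists, and $M=2.3297\ldots$, that is, $2.3297\le M<2.3298$. For every $f\in\mathcal{S}$, $$|a_5|-|a_4|\le M=2.3297\ldots.$$ -/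

import Mathlib

/-- The class `S`: functions that are analytic and univalent in the open unit disc and have an
expansion `f z = z + a₂ z ^ 2 + a₃ z ^ 3 + ⋯` there, that is, `f 0 = 0` and `f' 0 = 1`.
Values of `f` outside the open unit disc are irrelevant. -/
structure IsClassS (f : ℂ → ℂ) : Prop where
  analytic : DifferentiableOn ℂ f (Metric.ball 0 1)
  univalent : Set.InjOn f (Metric.ball 0 1)
  map_zero : f 0 = 0
  deriv_zero : deriv f 0 = 1

/-- The `n`-th Taylor coefficient of `f` at the origin. -/
noncomputable def taylorCoeff (f : ℂ → ℂ) (n : ℕ) : ℂ :=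
  iteratedDeriv n f 0 / (n.factorial : ℂ)

/-- The real function to be maximized. -/
def phiTwo (x y z t : ℝ) : ℝ :=
  x ^ 4 + 3 * y ^ 2 + 6 * x ^ 2 * y + 4 * x * z + 2 * t

/-- The region on which the maximum is taken, as a set of quadruples `(x, y, z, t)`. -/
def grunskyRegion : Set (ℝ × ℝ × ℝ × ℝ) :=
  {p | 0 ≤ p.1 ∧ p.1 ≤ 1 ∧
    0 ≤ p.2.1 ∧ p.2.1 ≤ 1 / Real.sqrt 3 * Real.sqrt (1 - p.1 ^ 2) ∧
    0 ≤ p.2.2.1 ∧ p.2.2.1 ≤ 1 / Real.sqrt 5 * Real.sqrt (1 - p.1 ^ 2 - 3 * p.2.1 ^ 2) ∧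
    0 ≤ p.2.2.2 ∧
    p.2.2.2 ≤ 1 / Real.sqrt 7 * Real.sqrt (1 - p.1 ^ 2 - 3 * p.2.1 ^ 2 - 5 * p.2.2.1 ^ 2)}

/-! Write `k` for the branch of √(z / f z) with `k 0 = 1`, and k = 1 - p z - q z² - r z³ - s z⁴ - ⋯.
Since f = z / k², both a₄ and a₅ are polynomials in p, q, r, s, and a₅ - p a₄ = p⁴ + 3q² + 6p²q +
4pr + 2s. If |p| ≤ 1, then |a₅| - |a₄| ≤ |a₅| - |p a₄| ≤ |a₅ - p a₄|, and the triangle inequality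
gives φ₂ at the moduli (`norm_sub_norm_le_phiTwo`).

These moduli lie in the region because G(z) = k(z²)/z = 1/√(f(z²)) is univalent in the punctured
disc, so that Gronwall's area theorem gives |p|² + 3|q|² + 5|r|² + 7|s|² ≤ 1 (`area_theorem_odd`).
It is proved without Jordan curves or Green's formula, by estimating the area of the image of an
annulus ρ < |z| < r in two ways. From below, the area is ∫|G'|², which Bessel's inequality on
circles bounds (`le_volume_image_annulus`). From above, injectivity and the pole confine the image
to the inside of the image of |z| = ρ, which is an ellipse up to O(ρ³)
(`exists_volume_image_annulus_le`). Then ρ → 0 and r → 1.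

The region is the part of a solid ellipsoid with nonnegative coordinates, hence compact. One
explicit point bounds M from below; a Lagrange multiplier depending on x² bounds it from above. -/

/-! ### The region and the numerical value of the maximum. -/

/-- The constraints of the region imply one quadratic inequality. -/
theorem sq_sum_le_of_mem_grunskyRegion {x y z t : ℝ} (h : (x, y, z, t) ∈ grunskyRegion) :
    x ^ 2 + 3 * y ^ 2 + 5 * z ^ 2 + 7 * t ^ 2 ≤ 1 := by
  obtain ⟨hx0, hx1, hy0, hy, hz0, hz, ht0, ht⟩ := h
  simp only at *
  -- `Real.sqrt` vanishes on negative numbers, so each radicand must be known to be nonnegative; the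
  -- inequality obtained for one variable supplies this for the next.
  have key : ∀ {a v c : ℝ}, 0 < c → 0 ≤ v → 0 ≤ a → v ≤ 1 / Real.sqrt c * Real.sqrt a →
      c * v ^ 2 ≤ a := by
    intro a v c hc hv ha h
    have h2 := pow_le_pow_left₀ hv h 2
    rw [mul_pow, div_pow, Real.sq_sqrt hc.le, Real.sq_sqrt ha] at h2
    calc c * v ^ 2 ≤ c * (1 ^ 2 / c * a) := by gcongr
      _ = a := by field_simp
  have h1 : 0 ≤ 1 - x ^ 2 := by nlinarith
  have h2 := key (by norm_num) hy0 h1 hy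
  have h3 := key (by norm_num) hz0 (by linarith) hz
  have h4 := key (by norm_num) ht0 (by linarith) ht
  linarith

theorem mem_grunskyRegion_of_sq_sum_le {x y z t : ℝ} (hx : 0 ≤ x) (hy : 0 ≤ y) (hz : 0 ≤ z)
    (ht : 0 ≤ t) (h : x ^ 2 + 3 * y ^ 2 + 5 * z ^ 2 + 7 * t ^ 2 ≤ 1) :
    (x, y, z, t) ∈ grunskyRegion := by
  have key : ∀ {a v c : ℝ}, 0 < c → 0 ≤ v → c * v ^ 2 ≤ a →
      v ≤ 1 / Real.sqrt c * Real.sqrt a := by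
    intro a v c hc hv h
    rw [one_div, inv_mul_eq_div, ← Real.sqrt_div' _ hc.le]
    apply Real.le_sqrt_of_sq_le
    rw [le_div_iff₀ hc]
    linarith
  refine ⟨hx, by nlinarith, hy, key (by norm_num) hy ?_, hz, key (by norm_num) hz ?_, ht,
    key (by norm_num) ht ?_⟩ <;> simp only <;> nlinarith

theorem isCompact_grunskyRegion : IsCompact grunskyRegion := by
  have hsub : grunskyRegion ⊆ Set.Icc (0, 0, 0, 0) (1, 1, 1, 1) := by
    rintro ⟨x, y, z, t⟩ h
    have hq := sq_sum_le_of_mem_grunskyRegion h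
    obtain ⟨hx0, hx1, hy0, -, hz0, -, ht0, -⟩ := h
    simp only at *
    refine ⟨⟨hx0, hy0, hz0, ht0⟩, hx1, ?_, ?_, ?_⟩ <;> simp only <;> nlinarith
  refine isCompact_Icc.of_isClosed_subset ?_ hsub
  simp only [grunskyRegion, Set.ofPred_and]
  iterate 7 refine IsClosed.inter (isClosed_le (by fun_prop) (by fun_prop)) ?_
  exact isClosed_le (by fun_prop) (by fun_prop)

/-- A Lagrange-multiplier bound for the maximized function on the ellipsoid. -/
theorem phiTwo_le_of_multiplier {x y z t c : ℝ} (hc : 2 < c)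
    (h : x ^ 2 + 3 * y ^ 2 + 5 * z ^ 2 + 7 * t ^ 2 ≤ 1) :
    phiTwo x y z t ≤ (x ^ 2) ^ 2 + 6 * (x ^ 2) ^ 2 / (c - 2) + c / 2 * (1 - x ^ 2) +
      (16 / 5 * x ^ 2 + 4 / 7) / (2 * c) := by
  have hc0 : 0 < c - 2 := by linarith
  -- Completing squares eliminates y, z and t, with equality at y = 2x²/(c - 2), z = 4x/(5c), t =
  -- 2/(7c); concavity in y is what requires c > 2.
  have hy : 3 * y ^ 2 + 6 * x ^ 2 * y ≤ 6 * (x ^ 2) ^ 2 / (c - 2) + c / 2 * (3 * y ^ 2) := by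
    have : 6 * (x ^ 2) ^ 2 / (c - 2) + c / 2 * (3 * y ^ 2) - (3 * y ^ 2 + 6 * x ^ 2 * y) =
        3 / 2 * (2 * x ^ 2 - (c - 2) * y) ^ 2 / (c - 2) := by
      field_simp
      ring
    have : 0 ≤ 3 / 2 * (2 * x ^ 2 - (c - 2) * y) ^ 2 / (c - 2) := by positivity
    linarith
  have hzt : 4 * x * z + 2 * t ≤ c / 2 * (5 * z ^ 2 + 7 * t ^ 2) +
      (16 / 5 * x ^ 2 + 4 / 7) / (2 * c) := by
    have : c / 2 * (5 * z ^ 2 + 7 * t ^ 2) + (16 / 5 * x ^ 2 + 4 / 7) / (2 * c) -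
        (4 * x * z + 2 * t) = ((5 * c * z - 4 * x) ^ 2 / 5 + (7 * c * t - 2) ^ 2 / 7) / (2 * c) := by
      field_simp
      ring
    have : 0 ≤ ((5 * c * z - 4 * x) ^ 2 / 5 + (7 * c * t - 2) ^ 2 / 7) / (2 * c) := by positivity
    linarith
  have := mul_le_mul_of_nonneg_left h (show 0 ≤ c / 2 by linarith)
  unfold phiTwo
  nlinarith

/-- With y, z, t eliminated, only u = x² in [0, 1] remains, and the multiplier c may be chosen as a
function of u. -/
theorem phiTwo_lt_of_sq_sum_le {x y z t : ℝ}
    (h : x ^ 2 + 3 * y ^ 2 + 5 * z ^ 2 + 7 * t ^ 2 ≤ 1) : phiTwo x y z t < 2.3298 := by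
  have hu0 : 0 ≤ x ^ 2 := sq_nonneg x
  have hu1 : x ^ 2 ≤ 1 := by nlinarith [sq_nonneg y, sq_nonneg z, sq_nonneg t]
  have key := fun c hc => phiTwo_le_of_multiplier (c := c) hc h
  generalize x ^ 2 = u at *
  -- Away from the maximum, which is near u = 0.685, there is enough room for a constant multiplier
  -- on each interval.
  rcases le_total u 0.55 with h1 | h1
  · refine (key 4.4 (by norm_num)).trans_lt ?_
    norm_num at *
    nlinarith
  rcases le_total u 0.62 with h2 | h2
  · refine (key 5.6 (by norm_num)).trans_lt ?_
    norm_num at *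
    nlinarith
  rcases le_total 0.8 u with h3 | h3
  · refine (key 9 (by norm_num)).trans_lt ?_
    norm_num at *
    nlinarith
  -- Near the maximum the multiplier has to follow u; this affine choice is close to the stationary
  -- value c ≈ 6.7 at u ≈ 0.685. `hpos` is the bound with denominators cleared.
  · have hc : 2 < 10 * u - 0.15 := by norm_num at *; linarith
    have hpos : 0 < (2.3298 - u ^ 2) * (2 * (10 * u - 0.15) * (10 * u - 0.15 - 2)) -
        12 * u ^ 2 * (10 * u - 0.15) - (10 * u - 0.15) ^ 2 * (10 * u - 0.15 - 2) * (1 - u) -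
        (16 / 5 * u + 4 / 7) * (10 * u - 0.15 - 2) := by
      norm_num at *
      nlinarith [sq_nonneg (u - 0.685), sq_nonneg (u ^ 2 - 0.469),
        mul_nonneg (sub_nonneg.2 h2) (sub_nonneg.2 h3),
        mul_nonneg (mul_nonneg (sub_nonneg.2 h2) (sub_nonneg.2 h3)) (sq_nonneg (u - 0.685))]
    refine (key _ hc).trans_lt ?_
    generalize 10 * u - 0.15 = c at *
    have hc0 : 0 < c := by linarith
    have hc2 : 0 < c - 2 := by linarith
    rw [← sub_pos]
    have e : 2.3298 - (u ^ 2 + 6 * u ^ 2 / (c - 2) + c / 2 * (1 - u) +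
        (16 / 5 * u + 4 / 7) / (2 * c)) = ((2.3298 - u ^ 2) * (2 * c * (c - 2)) -
        12 * u ^ 2 * c - c ^ 2 * (c - 2) * (1 - u) - (16 / 5 * u + 4 / 7) * (c - 2)) /
        (2 * c * (c - 2)) := by
      field_simp
      ring
    rw [e]
    positivity

theorem exists_isGreatest_phiTwo :
    ∃ M : ℝ,
      IsGreatest ((fun p : ℝ × ℝ × ℝ × ℝ => phiTwo p.1 p.2.1 p.2.2.1 p.2.2.2) '' grunskyRegion) M ∧
      (2.3297 : ℝ) ≤ M ∧ M < (2.3298 : ℝ) := by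
  -- A rounded approximate maximizer: the equality case of the multiplier bound for c ≈ 6.707, just
  -- inside the ellipsoid.
  have hmem : ((0.827453, 0.290924, 0.098698, 0.042599) : ℝ × ℝ × ℝ × ℝ) ∈ grunskyRegion :=
    mem_grunskyRegion_of_sq_sum_le (by norm_num) (by norm_num) (by norm_num) (by norm_num)
      (by norm_num)
  have hcont : Continuous fun p : ℝ × ℝ × ℝ × ℝ => phiTwo p.1 p.2.1 p.2.2.1 p.2.2.2 := by
    unfold phiTwo
    fun_prop
  obtain ⟨M, hM⟩ := (isCompact_grunskyRegion.image hcont).exists_isGreatest ⟨_, _, hmem, rfl⟩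
  refine ⟨M, hM, ?_, ?_⟩
  · refine le_trans ?_ (hM.2 ⟨_, hmem, rfl⟩)
    norm_num [phiTwo]
  · obtain ⟨⟨⟨x, y, z, t⟩, hp, rfl⟩, -⟩ := hM
    exact phiTwo_lt_of_sq_sum_le (sq_sum_le_of_mem_grunskyRegion hp)

/-! ### Taylor coefficients and the relation between f and k. -/

open Finset in
/-- Taylor coefficients of a product are given by the Cauchy product. -/
theorem taylorCoeff_mul {f g : ℂ → ℂ} (hf : AnalyticAt ℂ f 0) (hg : AnalyticAt ℂ g 0) (n : ℕ) :
    taylorCoeff (fun z => f z * g z) n =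
      ∑ i ∈ range (n + 1), taylorCoeff f i * taylorCoeff g (n - i) := by
  unfold taylorCoeff
  rw [iteratedDeriv_fun_mul hf.contDiffAt hg.contDiffAt, sum_div]
  refine sum_congr rfl fun i hi => ?_
  have hi' : i ≤ n := by simpa [Nat.lt_succ_iff] using hi
  rw [Nat.cast_choose ℂ hi']
  have := Nat.factorial_ne_zero
  have h1 : (n.factorial : ℂ) ≠ 0 := by exact_mod_cast this n
  have h2 : (i.factorial : ℂ) ≠ 0 := by exact_mod_cast this i
  have h3 : ((n - i).factorial : ℂ) ≠ 0 := by exact_mod_cast this (n - i)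
  field_simp

theorem taylorCoeff_zero (f : ℂ → ℂ) : taylorCoeff f 0 = f 0 := by
  simp [taylorCoeff]

theorem taylorCoeff_id (n : ℕ) : taylorCoeff (fun z => z) n = if n = 1 then 1 else 0 := by
  unfold taylorCoeff
  rw [iteratedDeriv_fun_id_zero]
  split_ifs with h <;> simp [h]

theorem taylorCoeff_congr {f g : ℂ → ℂ} (h : f =ᶠ[nhds 0] g) (n : ℕ) :
    taylorCoeff f n = taylorCoeff g n := by
  simp [taylorCoeff, h.iteratedDeriv_eq n]

theorem taylorCoeff_deriv (f : ℂ → ℂ) (n : ℕ) :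
    taylorCoeff (deriv f) n = (n + 1) * taylorCoeff f (n + 1) := by
  unfold taylorCoeff
  rw [iteratedDeriv_succ', Nat.factorial_succ]
  have h1 : (n.factorial : ℂ) ≠ 0 := by exact_mod_cast Nat.factorial_ne_zero n
  have h2 : (n + 1 : ℂ) ≠ 0 := by exact_mod_cast n.succ_ne_zero
  push_cast
  field_simp

/-- Dividing off a root at the origin shifts the Taylor coefficients. -/
theorem taylorCoeff_dslope {f : ℂ → ℂ} (hf : AnalyticAt ℂ f 0) (n : ℕ) :
    taylorCoeff (dslope f 0) n = taylorCoeff f (n + 1) := by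
  have h1 := hf.hasFPowerSeriesAt.has_fpower_series_dslope_fslope
  have h2 := h1.analyticAt.hasFPowerSeriesAt.eq_formalMultilinearSeries h1
  have h3 := congrArg (fun p => FormalMultilinearSeries.coeff p n) h2
  simpa [taylorCoeff, FormalMultilinearSeries.coeff_ofScalars] using h3

/-- If `f k² = z` with `k 0 = 1`, the first Taylor coefficients of `f` are polynomials in those of
`k`. -/
theorem taylorCoeff_eq_of_mul_sq_eq_id {f k : ℂ → ℂ} (hf : AnalyticAt ℂ f 0)
    (hk : AnalyticAt ℂ k 0) (hk0 : k 0 = 1) (h : (fun z => f z * (k z * k z)) =ᶠ[nhds 0] fun z => z)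
    {p q r s : ℂ} (hp : taylorCoeff k 1 = -p) (hq : taylorCoeff k 2 = -q)
    (hr : taylorCoeff k 3 = -r) (hs : taylorCoeff k 4 = -s) :
    taylorCoeff f 4 = 2 * r + 6 * p * q + 4 * p ^ 3 ∧
      taylorCoeff f 5 = 2 * s + 6 * p * r + 3 * q ^ 2 + 12 * p ^ 2 * q + 5 * p ^ 4 := by
  -- Comparing coefficients in f · k² = z gives a triangular system, solved successively for a₁, …,
  -- a₅.
  have hc (n : ℕ) := (taylorCoeff_mul hf (hk.mul hk) n).symm.trans
    ((taylorCoeff_congr h n).trans (taylorCoeff_id n))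
  have hkk (n : ℕ) := taylorCoeff_mul hk hk n
  have hk00 : taylorCoeff k 0 = 1 := (taylorCoeff_zero k).trans hk0
  have e0 := hkk 0
  have e1 := hkk 1
  have e2 := hkk 2
  have e3 := hkk 3
  have e4 := hkk 4
  have e5 := hkk 5
  have c0 := hc 0
  have c1 := hc 1
  have c2 := hc 2
  have c3 := hc 3
  have c4 := hc 4
  have c5 := hc 5
  simp only [Finset.sum_range_succ, Finset.sum_range_zero, Nat.sub_zero, Nat.reduceAdd,
    Nat.reduceSub, hk00, hp, hq, hr, hs, zero_add, one_mul, mul_one, Pi.mul_def] at e0 e1 e2 e3 e4 e5 c0 c1 c2 c3 c4 c5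
  simp only [e0, e1, e2, e3, e4, e5] at c0 c1 c2 c3 c4 c5
  norm_num at c0 c1 c2 c3 c4 c5
  simp only [c0] at c1 c2 c3 c4 c5
  norm_num at c1 c2 c3 c4 c5
  rw [c1] at c2 c3 c4 c5
  have a2 : taylorCoeff f 2 = 2 * p := by linear_combination c2
  rw [a2] at c3 c4 c5
  have a3 : taylorCoeff f 3 = 2 * q + 3 * p ^ 2 := by linear_combination c3
  rw [a3] at c4 c5
  have a4 : taylorCoeff f 4 = 2 * r + 6 * p * q + 4 * p ^ 3 := by linear_combination c4
  rw [a4] at c5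
  exact ⟨a4, by linear_combination c5⟩

/-- The difference `|a₅| - |a₄|` is bounded by the maximized function at the moduli of the
coefficients of the square root transform. -/
theorem norm_sub_norm_le_phiTwo {a₄ a₅ p q r s : ℂ} (h4 : a₄ = 2 * r + 6 * p * q + 4 * p ^ 3)
    (h5 : a₅ = 2 * s + 6 * p * r + 3 * q ^ 2 + 12 * p ^ 2 * q + 5 * p ^ 4) (hp : ‖p‖ ≤ 1) :
    ‖a₅‖ - ‖a₄‖ ≤ phiTwo ‖p‖ ‖q‖ ‖r‖ ‖s‖ := by
  have h1 : ‖p * a₄‖ ≤ ‖a₄‖ := by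
    rw [norm_mul]
    exact mul_le_of_le_one_left (norm_nonneg _) hp
  -- Subtracting p a₄ lowers the coefficients of a₅ but leaves them nonnegative, so the triangle
  -- inequality reproduces φ₂ exactly.
  have h2 : ‖a₅ - p * a₄‖ ≤ phiTwo ‖p‖ ‖q‖ ‖r‖ ‖s‖ := by
    have : a₅ - p * a₄ = p ^ 4 + 3 * q ^ 2 + 6 * p ^ 2 * q + 4 * p * r + 2 * s := by
      rw [h4, h5]
      ring
    rw [this, phiTwo]
    refine (norm_add_le _ _).trans (add_le_add ((norm_add_le _ _).trans (add_le_add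
      ((norm_add_le _ _).trans (add_le_add ((norm_add_le _ _).trans (add_le_add ?_ ?_)) ?_)) ?_)) ?_)
    all_goals simp
  linarith [norm_sub_norm_le a₅ (p * a₄)]

/-! ### Bessel's inequality on circles. -/

open Metric Real Set in
/-- One step of Parseval's identity: split off the constant term on a circle. -/
theorem circleAverage_normSq_const_add {s : ℝ} (c : ℂ) {g : ℂ → ℂ}
    (hg : DifferentiableOn ℂ g (ball 0 1)) (hs0 : 0 ≤ s) (hs1 : s < 1) (hg0 : g 0 = 0) :
    circleAverage (fun z => ‖c + g z‖ ^ 2) 0 s =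
      ‖c‖ ^ 2 + circleAverage (fun z => ‖g z‖ ^ 2) 0 s := by
  have hsub : closedBall (0 : ℂ) |s| ⊆ ball 0 1 := by
    rw [abs_of_nonneg hs0]
    exact closedBall_subset_ball hs1
  have hcont : ContinuousOn g (sphere 0 |s|) :=
    hg.continuousOn.mono (sphere_subset_closedBall.trans hsub)
  have hmean : circleAverage g 0 s = 0 := by
    rw [DiffContOnCl.circleAverage, hg0]
    exact (hg.mono (closure_ball_subset_closedBall.trans hsub)).diffContOnCl
  -- The cross term 2 Re(c̄ g) is a real-linear functional of g, so its average is its value at the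
  -- mean of g, which is g(0) = 0.
  let L : ℂ →L[ℝ] ℝ := (2 : ℝ) • (innerSL ℝ c)
  have hL : circleAverage (fun z => L (g z)) 0 s = 0 := by
    have := L.circleAverage_comp_comm (f := g) (c := 0) (R := s) hcont.circleIntegrable'
    rw [hmean, map_zero] at this
    exact this
  have e : (fun z => ‖c + g z‖ ^ 2) = fun z => (‖c‖ ^ 2 + L (g z)) + ‖g z‖ ^ 2 := by
    ext z
    rw [norm_add_sq_real]
    simp [L]
  have hLg : ContinuousOn (fun z => L (g z)) (sphere 0 |s|) := L.continuous.comp_continuousOn hcont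
  rw [e, circleAverage_fun_add (f₁ := fun z => ‖c‖ ^ 2 + L (g z)), circleAverage_fun_add, hL,
    circleAverage_const, add_zero]
  · exact continuousOn_const.circleIntegrable'
  · exact hLg.circleIntegrable'
  · exact (continuousOn_const.add hLg).circleIntegrable'
  · exact (hcont.norm.pow 2).circleIntegrable'

open Metric Real Set in
/-- Bessel's inequality for the Taylor coefficients of `u`, on circles, after substituting `z²`. -/
theorem sum_taylorCoeff_le_circleAverage_comp_sq {s : ℝ} (hs0 : 0 ≤ s) (hs1 : s < 1) (N : ℕ) :
    ∀ {u : ℂ → ℂ}, DifferentiableOn ℂ u (ball 0 1) →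
    ∑ n ∈ Finset.range N, ‖taylorCoeff u n‖ ^ 2 * s ^ (4 * n) ≤
      circleAverage (fun z => ‖u (z ^ 2)‖ ^ 2) 0 s := by
  have hball : (ball (0 : ℂ) 1) ∈ nhds 0 := ball_mem_nhds _ one_pos
  induction N with
  | zero =>
    intro u hu
    simpa using circleAverage_nonneg_of_nonneg fun _ _ => by positivity
  | succ N ih =>
    intro u hu
    have hd : DifferentiableOn ℂ (dslope u 0) (ball 0 1) :=
      (Complex.differentiableOn_dslope hball).2 hu
    have hg : DifferentiableOn ℂ (fun z => z ^ 2 * dslope u 0 (z ^ 2)) (ball 0 1) := by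
      refine (differentiableOn_id.pow 2).mul (hd.comp (differentiableOn_id.pow 2) fun z hz => ?_)
      simp only [mem_ball_zero_iff, norm_pow] at *
      nlinarith [norm_nonneg z]
    -- Induction by peeling off the constant term: u(w) = u(0) + w v(w), where v has the shifted
    -- coefficients, and |z²|² = s⁴ on the circle.
    have e : (fun z => ‖u (z ^ 2)‖ ^ 2) =
        fun z => ‖u 0 + z ^ 2 * dslope u 0 (z ^ 2)‖ ^ 2 := by
      ext z
      have := sub_smul_dslope u 0 (z ^ 2)
      rw [sub_zero, smul_eq_mul] at this
      rw [this]
      simp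
    have e2 : circleAverage (fun z => ‖z ^ 2 * dslope u 0 (z ^ 2)‖ ^ 2) 0 s =
        s ^ 4 * circleAverage (fun z => ‖dslope u 0 (z ^ 2)‖ ^ 2) 0 s := by
      rw [← smul_eq_mul, ← circleAverage_fun_smul]
      refine circleAverage_congr_sphere fun z hz => ?_
      have : ‖z‖ = s := by simpa [abs_of_nonneg hs0] using hz
      simp only [norm_mul, norm_pow, this, smul_eq_mul]
      ring
    rw [e, circleAverage_normSq_const_add _ hg hs0 hs1 (by simp), e2, Finset.sum_range_succ',
      taylorCoeff_zero]
    have := mul_le_mul_of_nonneg_left (ih hd) (show 0 ≤ s ^ 4 by positivity)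
    simp only [taylorCoeff_dslope (hu.analyticAt hball), Finset.mul_sum] at this
    simp only [mul_zero, pow_zero, mul_one]
    rw [add_comm]
    gcongr
    refine le_trans (le_of_eq (Finset.sum_congr rfl fun n _ => ?_)) this
    ring

/-! ### Images of univalent functions with a pole. -/

-- Polar coordinates present the set as a continuous image of a convex set of pairs (modulus,
-- angle). Intersecting with `Ici 0` covers negative R.
open Metric Set Filter Topology in
theorem isPreconnected_setOf_lt_norm (R : ℝ) : IsPreconnected {w : ℂ | R < ‖w‖} := by
  have hS : {w : ℂ | R < ‖w‖} =
      (fun p : ℝ × ℝ => (p.1 : ℂ) * Complex.exp (p.2 * Complex.I)) ''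
        ((Ioi R ∩ Ici 0) ×ˢ univ) := by
    ext w
    constructor
    · intro hw
      exact ⟨(‖w‖, w.arg), ⟨⟨hw, norm_nonneg w⟩, mem_univ _⟩, Complex.norm_mul_exp_arg_mul_I w⟩
    · rintro ⟨⟨a, b⟩, ⟨⟨ha, hb⟩, -⟩, rfl⟩
      have hb' : |a| = a := abs_of_nonneg hb
      simpa [Complex.norm_exp_ofReal_mul_I, hb'] using ha
  rw [hS]
  refine IsPreconnected.image (IsPreconnected.prod ?_ isPreconnected_univ) _ ?_
  · exact ((ordConnected_Ioi).inter ordConnected_Ici).isPreconnected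
  · fun_prop

open Metric Set Filter Topology in
/-- An injective open map with a pole at the origin sends the part of the disc outside a circle into
any disc that contains the image of the circle. -/
theorem norm_le_of_injOn_of_pole {H : ℂ → ℂ} {ρ R : ℝ} (hρ0 : 0 < ρ) (hρ1 : ρ < 1)
    (hcont : ContinuousOn H (ball 0 1 \ {0})) (hinj : InjOn H (ball 0 1 \ {0}))
    (hopen : IsOpen (H '' (ball 0 ρ \ {0})))
    (hpole : Tendsto (fun z => ‖H z‖) (𝓝[≠] 0) atTop)
    (hR : ∀ z, ‖z‖ = ρ → ‖H z‖ ≤ R) {z : ℂ} (hz : ρ < ‖z‖) (hz1 : ‖z‖ < 1) : ‖H z‖ ≤ R := by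
  by_contra! hlt
  -- The punctured disc of radius ρ already covers everything outside the disc of radius R, so by
  -- injectivity no point with |z| > ρ can be sent there.
  have hsub : {w : ℂ | R < ‖w‖} ⊆ H '' (ball 0 ρ \ {0}) := by
    have hbig : ∀ K : ℝ, ∃ δ > 0, ∀ z : ℂ, ‖z‖ < δ → z ≠ 0 → K ≤ ‖H z‖ := by
      intro K
      have := (hpole.eventually_ge_atTop K)
      rw [eventually_nhdsWithin_iff, Metric.eventually_nhds_iff] at this
      obtain ⟨δ, hδ, h⟩ := this
      exact ⟨δ, hδ, fun z hz hz0 => h (by simpa using hz) hz0⟩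
    -- Connectedness: within |w| > R the image is open, nonempty by the pole, and relatively closed.
    refine (isPreconnected_setOf_lt_norm R).subset_of_closure_inter_subset hopen ?_ ?_
    · obtain ⟨δ, hδ, h⟩ := hbig (R + 1)
      have hm : 0 < min δ ρ := lt_min hδ hρ0
      have hn : ‖((min δ ρ / 2 : ℝ) : ℂ)‖ = min δ ρ / 2 := by
        rw [Complex.norm_real, Real.norm_of_nonneg (by positivity)]
      have h0 : ((min δ ρ / 2 : ℝ) : ℂ) ≠ 0 := by
        rw [← norm_pos_iff, hn]
        positivity
      refine ⟨H ((min δ ρ / 2 : ℝ) : ℂ), ?_, mem_image_of_mem _ ⟨?_, h0⟩⟩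
      · have := h _ (by rw [hn]; linarith [min_le_left δ ρ]) h0
        simp only [mem_ofPred_eq]
        linarith
      · rw [mem_ball_zero_iff, hn]
        linarith [min_le_right δ ρ]
    · rintro w ⟨hwc, hw⟩
      -- Points with |z| < δ have values too large to accumulate at w, so w is a value on the
      -- compact set δ ≤ |z| ≤ ρ; |z| = ρ is excluded because there |H| ≤ R.
      obtain ⟨δ, hδ, h⟩ := hbig (‖w‖ + 1)
      set K : Set ℂ := closedBall 0 ρ \ ball 0 δ with hK
      have hKc : IsCompact (H '' K) := by
        refine IsCompact.image_of_continuousOn ((isCompact_closedBall _ _).diff isOpen_ball)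
          (hcont.mono ?_)
        rintro x ⟨hx1, hx2⟩
        simp only [mem_closedBall_zero_iff, mem_ball_zero_iff, not_lt] at hx1 hx2
        refine ⟨by simpa using hx1.trans_lt hρ1, ?_⟩
        rintro rfl
        simp at hx2
        linarith
      have hcov : H '' (ball 0 ρ \ {0}) ⊆ H '' K ∪ {v | ‖w‖ + 1 ≤ ‖v‖} := by
        rintro _ ⟨x, ⟨hx1, hx0⟩, rfl⟩
        rcases lt_or_ge ‖x‖ δ with hx | hx
        · exact Or.inr (h x hx hx0)
        · refine Or.inl (mem_image_of_mem _ ⟨ball_subset_closedBall hx1, by simpa using hx⟩)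
      have hcl : IsClosed (H '' K ∪ {v | ‖w‖ + 1 ≤ ‖v‖}) :=
        hKc.isClosed.union (isClosed_le continuous_const continuous_norm)
      rcases closure_minimal hcov hcl hwc with ⟨x, ⟨hx1, hx2⟩, rfl⟩ | hw'
      · simp only [mem_closedBall_zero_iff, mem_ball_zero_iff, not_lt] at hx1 hx2
        refine mem_image_of_mem _ ⟨?_, ?_⟩
        · rw [mem_ball_zero_iff]
          refine lt_of_le_of_ne hx1 fun he => ?_
          exact absurd (hR x he) (not_le.2 hw)
        · rintro rfl
          simp at hx2
          linarith
      · simp only [mem_ofPred_eq] at hw'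
        linarith
  obtain ⟨x, ⟨hx, hx0⟩, hxz⟩ := hsub hlt
  rw [mem_ball_zero_iff] at hx
  have hne : z ≠ 0 := norm_pos_iff.1 (hρ0.trans hz)
  have := hinj ⟨by simpa using hx.trans hρ1, hx0⟩ ⟨by simpa using hz1, hne⟩ hxz
  rw [this] at hx
  linarith

/-! ### A linear map that takes ellipses to circles. -/

/-- The real-linear map `w ↦ w - b * conj w`. -/
noncomputable def subMulConj (b : ℂ) : ℂ →L[ℝ] ℂ :=
  ContinuousLinearMap.id ℝ ℂ - b • (Complex.conjCLE : ℂ →L[ℝ] ℂ)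

theorem subMulConj_apply (b w : ℂ) : subMulConj b w = w - b * (starRingEnd ℂ) w := by
  simp [subMulConj]

theorem det_subMulConj (b : ℂ) :
    LinearMap.det (subMulConj b : ℂ →ₗ[ℝ] ℂ) = 1 - ‖b‖ ^ 2 := by
  rw [← LinearMap.det_toMatrix Complex.basisOneI, Matrix.det_fin_two]
  simp [LinearMap.toMatrix_apply, subMulConj_apply, Complex.sq_norm, Complex.normSq_apply]
  ring

-- The preimage of the disc is a filled ellipse, and its area is that of the disc divided by the
-- determinant 1 - |b|².
open MeasureTheory in
theorem volume_preimage_subMulConj {b : ℂ} (hb : ‖b‖ < 1) {R : ℝ} (hR : 0 ≤ R) :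
    volume (subMulConj b ⁻¹' Metric.closedBall 0 R) =
      ENNReal.ofReal (Real.pi * R ^ 2 / (1 - ‖b‖ ^ 2)) := by
  have h : 0 < 1 - ‖b‖ ^ 2 := by nlinarith [norm_nonneg b]
  rw [Measure.addHaar_preimage_continuousLinearMap, det_subMulConj, Complex.volume_closedBall,
    ← ENNReal.ofReal_pow hR, abs_of_pos (by positivity),
    show (NNReal.pi : ENNReal) = ENNReal.ofReal Real.pi from ?_, ← ENNReal.ofReal_mul (by positivity),
    ← ENNReal.ofReal_mul (by positivity)]
  · congr 1
    field_simp
  · rw [← NNReal.coe_real_pi, ENNReal.ofReal_coe_nnreal]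
  · rw [det_subMulConj]
    exact h.ne'

theorem injective_subMulConj {b : ℂ} (hb : ‖b‖ < 1) : Function.Injective (subMulConj b) := by
  rw [injective_iff_map_eq_zero]
  intro w hw
  rw [subMulConj_apply, sub_eq_zero] at hw
  have := congrArg norm hw
  rw [norm_mul, RCLike.norm_conj] at this
  rw [← norm_eq_zero]
  nlinarith [norm_nonneg w]

/-! ### Area integrals over an annulus in polar coordinates. -/

open Set MeasureTheory in
/-- Lower bound for an integral over an annulus through averages over circles. -/
theorem ofReal_integral_le_lintegral_annulus {F : ℂ → ℝ} {ρ r : ℝ} (hρ : 0 < ρ) (hρr : ρ ≤ r)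
    (hF : ContinuousOn F {z | ρ < ‖z‖ ∧ ‖z‖ < r}) (hF0 : ∀ z, 0 ≤ F z) {m : ℝ → ℝ}
    (hmc : ContinuousOn m (Icc ρ r)) (hm0 : ∀ s ∈ Ioo ρ r, 0 ≤ m s)
    (hm : ∀ s ∈ Ioo ρ r, m s ≤ 2 * Real.pi * s * Real.circleAverage F 0 s) :
    ENNReal.ofReal (∫ s in ρ..r, m s) ≤
      ∫⁻ z in {z : ℂ | ρ < ‖z‖ ∧ ‖z‖ < r}, ENNReal.ofReal (F z) := by
  set A : Set ℂ := {z : ℂ | ρ < ‖z‖ ∧ ‖z‖ < r} with hA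
  have hAm : MeasurableSet A := by
    refine IsOpen.measurableSet ?_
    exact (isOpen_lt continuous_const continuous_norm).inter
      (isOpen_lt continuous_norm continuous_const)
  have hΦ : Measurable (A.indicator fun z => ENNReal.ofReal (F z)) := by
    classical
    rw [← piecewise_eq_indicator]
    exact ContinuousOn.measurable_piecewise (ENNReal.continuous_ofReal.comp_continuousOn hF)
      continuousOn_const hAm
  have hcirc (s θ : ℝ) : Complex.polarCoord.symm (s, θ) = circleMap 0 s θ := by
    rw [Complex.polarCoord_symm_apply, circleMap, zero_add, Complex.exp_mul_I]
    push_cast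
    rfl
  have hmeas : Measurable fun p : ℝ × ℝ => ENNReal.ofReal p.1 •
      A.indicator (fun z => ENNReal.ofReal (F z)) (Complex.polarCoord.symm p) := by
    refine (ENNReal.measurable_ofReal.comp measurable_fst).smul (hΦ.comp ?_)
    rw [show (Complex.polarCoord.symm : ℝ × ℝ → ℂ) = fun p => circleMap 0 p.1 p.2 from
      funext fun p => hcirc p.1 p.2]
    simp only [circleMap]
    fun_prop
  have hinner : ∀ s ∈ Ioo ρ r, ENNReal.ofReal (m s) ≤ ∫⁻ θ in Ioo (-Real.pi) Real.pi,
      ENNReal.ofReal s • A.indicator (fun z => ENNReal.ofReal (F z))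
        (Complex.polarCoord.symm (s, θ)) := by
    intro s hs
    have hs0 : 0 < s := hρ.trans hs.1
    have hmem (θ : ℝ) : circleMap 0 s θ ∈ A := by
      simpa [hA, abs_of_pos hs0] using hs
    have hcont : Continuous fun θ => F (circleMap 0 s θ) :=
      hF.comp_continuous (continuous_circleMap 0 s) hmem
    -- The average is defined over [0, 2π], polar coordinates use (-π, π); the average may start at
    -- any angle.
    have e1 : Real.circleAverage F 0 s =
        (2 * Real.pi)⁻¹ * ∫ θ in Ioo (-Real.pi) Real.pi, F (circleMap 0 s θ) := by
      rw [Real.circleAverage_eq_integral_add (-Real.pi), ← integral_Ioc_eq_integral_Ioo,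
        ← intervalIntegral.integral_of_le (by linarith [Real.pi_pos]), smul_eq_mul,
        intervalIntegral.integral_comp_add_right (fun θ => F (circleMap 0 s θ))]
      congr 3 <;> ring
    simp only [hcirc, indicator_of_mem (hmem _), smul_eq_mul]
    rw [lintegral_const_mul _ hcont.measurable.ennreal_ofReal, ← ofReal_integral_eq_lintegral_ofReal,
      ← ENNReal.ofReal_mul hs0.le]
    · refine ENNReal.ofReal_le_ofReal ((hm s hs).trans (le_of_eq ?_))
      rw [e1]
      field_simp
    · exact (hcont.integrableOn_Icc).mono_set Ioo_subset_Icc_self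
    · exact Filter.Eventually.of_forall fun _ => hF0 _
  calc ENNReal.ofReal (∫ s in ρ..r, m s) = ∫⁻ s in Ioo ρ r, ENNReal.ofReal (m s) := by
        rw [intervalIntegral.integral_of_le hρr, integral_Ioc_eq_integral_Ioo,
          ofReal_integral_eq_lintegral_ofReal]
        · exact (hmc.integrableOn_Icc).mono_set Ioo_subset_Icc_self
        · exact ae_restrict_of_forall_mem measurableSet_Ioo hm0
    _ ≤ ∫⁻ s in Ioo ρ r, ∫⁻ θ in Ioo (-Real.pi) Real.pi,
          ENNReal.ofReal s • A.indicator (fun z => ENNReal.ofReal (F z))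
            (Complex.polarCoord.symm (s, θ)) := setLIntegral_mono' measurableSet_Ioo hinner
    _ ≤ ∫⁻ s in Ioi 0, ∫⁻ θ in Ioo (-Real.pi) Real.pi,
          ENNReal.ofReal s • A.indicator (fun z => ENNReal.ofReal (F z))
            (Complex.polarCoord.symm (s, θ)) :=
        lintegral_mono_set fun s hs => hρ.trans hs.1
    _ = ∫⁻ z in A, ENNReal.ofReal (F z) := by
        rw [← lintegral_indicator hAm, ← Complex.lintegral_comp_polarCoord_symm, polarCoord_target,
          Measure.volume_eq_prod, setLIntegral_prod _ hmeas.aemeasurable]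

/-! ### The area theorem for G(z) = k(z²)/z. -/

/-- With u(w) = 2w k'(w) - k(w) one has G'(z) = u(z²)/z². The factors 2n - 1 are the exponents of G.
-/
theorem taylorCoeff_two_mul_deriv_sub {k : ℂ → ℂ} (hk : AnalyticAt ℂ k 0) (n : ℕ) :
    taylorCoeff (fun w => w * (2 * deriv k w) - k w) n = (2 * n - 1) * taylorCoeff k n := by
  have h1 : AnalyticAt ℂ (fun w => 2 * deriv k w) 0 := analyticAt_const.mul hk.deriv
  have h2 : AnalyticAt ℂ (fun w => w * (2 * deriv k w)) 0 := analyticAt_id.mul h1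
  have h3 : taylorCoeff (fun w => w * (2 * deriv k w) - k w) n =
      taylorCoeff (fun w => w * (2 * deriv k w)) n - taylorCoeff k n := by
    unfold taylorCoeff
    rw [iteratedDeriv_fun_sub h2.contDiffAt hk.contDiffAt, sub_div]
  have h4 (j : ℕ) : taylorCoeff (fun w => 2 * deriv k w) j =
      2 * ((j + 1) * taylorCoeff k (j + 1)) := by
    rw [← taylorCoeff_deriv]
    unfold taylorCoeff
    rw [iteratedDeriv_const_mul_field, mul_div_assoc]
  rw [h3, taylorCoeff_mul (f := fun w => w) analyticAt_id h1]
  simp only [taylorCoeff_id, ite_mul, one_mul, zero_mul, Finset.sum_ite_eq']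
  cases n with
  | zero => simp
  | succ n =>
    simp [h4]
    ring

open Metric Set in
theorem hasDerivAt_comp_sq_div {k : ℂ → ℂ} (hk : DifferentiableOn ℂ k (ball 0 1)) {z : ℂ}
    (hz : ‖z‖ < 1) (hz0 : z ≠ 0) :
    HasDerivAt (fun z => k (z ^ 2) / z) ((z ^ 2 * (2 * deriv k (z ^ 2)) - k (z ^ 2)) / z ^ 2) z := by
  have hz2 : z ^ 2 ∈ ball (0 : ℂ) 1 := by
    rw [mem_ball_zero_iff, norm_pow]
    nlinarith [norm_nonneg z]
  have h1 := (hk.differentiableAt (isOpen_ball.mem_nhds hz2)).hasDerivAt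
  have h2 := (h1.comp z (hasDerivAt_pow 2 z)).div (hasDerivAt_id z) hz0
  refine h2.congr_deriv ?_
  simp only [Function.comp_apply, id, Nat.cast_ofNat]
  ring

open Metric Set Filter Topology MeasureTheory in
/-- The image of an annulus under `z ↦ k (z ^ 2) / z` lies in an almost elliptic region. -/
theorem exists_volume_image_annulus_le {k : ℂ → ℂ} (hk : DifferentiableOn ℂ k (ball 0 1))
    (hk0 : k 0 = 1) (hinj : InjOn (fun z => k (z ^ 2) / z) (ball 0 1 \ {0})) :
    ∃ C : ℝ, 0 ≤ C ∧ ∀ᶠ ρ : ℝ in 𝓝[>] 0, ∀ r ≤ 1,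
      volume ((fun z => k (z ^ 2) / z) '' {z : ℂ | ρ < ‖z‖ ∧ ‖z‖ < r}) ≤
        ENNReal.ofReal (Real.pi * (1 / ρ ^ 2 + (4 * C * ρ ^ 2 + 8 * C ^ 2 * ρ ^ 6))) := by
  set G : ℂ → ℂ := fun z => k (z ^ 2) / z with hG
  have hball : ball (0 : ℂ) 1 ∈ 𝓝 0 := ball_mem_nhds _ one_pos
  set β := dslope k 0 0 with hβ
  set κ := dslope (dslope k 0) 0 with hκ
  have hκc : DifferentiableOn ℂ κ (ball 0 1) :=
    (Complex.differentiableOn_dslope hball).2 ((Complex.differentiableOn_dslope hball).2 hk)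
  -- Hence G(z) = 1/z + βz + O(z³). Enclosing the image of |z| = ρ in a disc of radius 1/ρ + |β|ρ +
  -- ⋯ would leave an error 2π|β| in the area that survives ρ → 0; the term βz must therefore be
  -- treated exactly, by an ellipse.
  have hexp (w : ℂ) : k w = 1 + β * w + w ^ 2 * κ w := by
    have h1 := sub_smul_dslope k 0 w
    have h2 := sub_smul_dslope (dslope k 0) 0 w
    simp only [sub_zero, smul_eq_mul, hk0] at h1 h2
    rw [eq_sub_iff_add_eq] at h1 h2
    rw [← h1, ← h2]
    ring
  obtain ⟨C, hC⟩ := (isCompact_closedBall (0 : ℂ) (1 / 2)).exists_bound_of_continuousOn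
    (hκc.continuousOn.mono (closedBall_subset_ball (by norm_num)))
  have hC0 : 0 ≤ C := (norm_nonneg _).trans (hC 0 (by simp))
  refine ⟨C, hC0, ?_⟩
  have hsmall : ∀ᶠ ρ : ℝ in 𝓝[>] 0, ‖β‖ * ρ ^ 2 < 1 / 2 := by
    have : Tendsto (fun ρ : ℝ => ‖β‖ * ρ ^ 2) (𝓝[>] 0) (𝓝 0) := by
      have : Continuous fun ρ : ℝ => ‖β‖ * ρ ^ 2 := by fun_prop
      simpa using (this.tendsto 0).mono_left nhdsWithin_le_nhds
    exact this.eventually_lt_const (by norm_num)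
  have hder (z : ℂ) (hz : z ∈ ball (0 : ℂ) 1 \ {0}) :=
    hasDerivAt_comp_sq_div hk (mem_ball_zero_iff.1 hz.1) hz.2
  have hGd : DifferentiableOn ℂ G (ball 0 1 \ {0}) := fun z hz =>
    (hder z hz).differentiableAt.differentiableWithinAt
  have hU : IsOpen (ball (0 : ℂ) 1 \ {0}) := isOpen_ball.sdiff isClosed_singleton
  have hpoleG : Tendsto (fun z => ‖G z‖) (𝓝[≠] 0) atTop := by
    have h1 : Tendsto (fun z : ℂ => ‖k (z ^ 2)‖) (𝓝[≠] 0) (𝓝 1) := by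
      have hc : ContinuousAt (fun z : ℂ => ‖k (z ^ 2)‖) 0 := by
        refine ContinuousAt.norm (ContinuousAt.comp (g := k) ?_ (by fun_prop))
        simpa using (hk.differentiableAt hball).continuousAt
      have := hc.tendsto
      simp only [ne_eq, OfNat.ofNat_ne_zero, not_false_eq_true, zero_pow, hk0, norm_one] at this
      exact this.mono_left nhdsWithin_le_nhds
    have h2 : Tendsto (fun z : ℂ => ‖z⁻¹‖) (𝓝[≠] 0) atTop :=
      tendsto_norm_cobounded_atTop.comp tendsto_inv₀_nhdsNE_zero
    refine (h1.pos_mul_atTop one_pos h2).congr fun z => ?_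
    simp only [hG, ← norm_mul, div_eq_mul_inv]
  filter_upwards [hsmall, self_mem_nhdsWithin,
    (eventually_lt_nhds (show (0 : ℝ) < 1 / 2 by norm_num)).filter_mono nhdsWithin_le_nhds]
    with ρ hb hρ hρ2 r hr
  rw [mem_Ioi] at hρ
  -- On |z| = ρ one has z = ρ² / z̄, so βz = b · conj(1/z). Thus 1/z + βz traces an ellipse, which w
  -- ↦ w - b w̄ maps to the circle of radius (1 - |b|²)/ρ.
  set b : ℂ := β * (ρ : ℂ) ^ 2 with hbdef
  have hbn : ‖b‖ = ‖β‖ * ρ ^ 2 := by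
    rw [hbdef, norm_mul, norm_pow, Complex.norm_real, Real.norm_of_nonneg hρ.le]
  have hb1 : ‖b‖ < 1 / 2 := hbn ▸ hb
  have hb2 : ‖b‖ ^ 2 ≤ 1 / 2 := by nlinarith [norm_nonneg b]
  set R : ℝ := (1 - ‖b‖ ^ 2) / ρ + 2 * C * ρ ^ 3 with hR
  have hR0 : 0 ≤ R := by
    have : 0 ≤ 1 - ‖b‖ ^ 2 := by linarith
    positivity
  have hSinj : Function.Injective (subMulConj b) := injective_subMulConj (by linarith)
  have hSopen : IsOpenMap (subMulConj b) := by
    refine (subMulConj b).isOpenMap ?_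
    exact LinearMap.surjective_of_injective (f := (subMulConj b : ℂ →ₗ[ℝ] ℂ)) hSinj
  have hSn (w : ℂ) : 1 / 2 * ‖w‖ ≤ ‖subMulConj b w‖ := by
    rw [subMulConj_apply]
    have h1 := norm_sub_norm_le w (b * (starRingEnd ℂ) w)
    rw [norm_mul, RCLike.norm_conj] at h1
    nlinarith [norm_nonneg w]
  have hcirc : ∀ z, ‖z‖ = ρ → ‖subMulConj b (G z)‖ ≤ R := by
    intro z hz
    have hz0 : z ≠ 0 := norm_pos_iff.1 (hz ▸ hρ)
    have hzz : (starRingEnd ℂ) z * z = (ρ : ℂ) ^ 2 := by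
      rw [mul_comm, Complex.mul_conj, Complex.normSq_eq_norm_sq, hz]
      push_cast
      rfl
    have hcz : (starRingEnd ℂ) z ≠ 0 := by simpa using hz0
    have hbb : b * (starRingEnd ℂ) b = ((‖b‖ ^ 2 : ℝ) : ℂ) := by
      rw [Complex.mul_conj, Complex.normSq_eq_norm_sq]
    set e := z ^ 3 * κ (z ^ 2) with he
    have hGz : G z = 1 / z + b * (starRingEnd ℂ) (1 / z) + e := by
      rw [hG, hbdef, ← hzz, he]
      simp only [hexp (z ^ 2), map_div₀, map_one]
      field_simp
    have hen : ‖e‖ ≤ C * ρ ^ 3 := by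
      rw [he, norm_mul, norm_pow, hz, mul_comm]
      have := hC (z ^ 2) (by
        rw [mem_closedBall_zero_iff, norm_pow, hz]
        nlinarith)
      gcongr
    have hS : subMulConj b (G z) =
        ((1 - ‖b‖ ^ 2 : ℝ) : ℂ) / z + (e - b * (starRingEnd ℂ) e) := by
      rw [subMulConj_apply, hGz, Complex.ofReal_sub, ← hbb]
      simp only [map_add, map_mul, map_div₀, map_one, Complex.conj_conj, Complex.ofReal_one]
      ring
    rw [hS, hR]
    refine (norm_add_le _ _).trans (add_le_add (le_of_eq ?_) ?_)
    · rw [norm_div, hz, Complex.norm_real, Real.norm_of_nonneg (by linarith)]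
    · refine (norm_sub_le _ _).trans ?_
      rw [norm_mul b, RCLike.norm_conj]
      nlinarith [norm_nonneg e]
  have hopen : IsOpen ((fun z => subMulConj b (G z)) '' (ball 0 ρ \ {0})) := by
    have : (fun z => subMulConj b (G z)) '' (ball 0 ρ \ {0}) =
      subMulConj b '' (G '' (ball 0 ρ \ {0})) := by rw [image_image]
    rw [this]
    refine hSopen _ ?_
    rw [isOpen_iff_mem_nhds]
    rintro _ ⟨z, hz, rfl⟩
    have hV : ball (0 : ℂ) ρ \ {0} ∈ 𝓝 z := (isOpen_ball.sdiff isClosed_singleton).mem_nhds hz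
    have hsub : ball (0 : ℂ) ρ \ {0} ⊆ ball 0 1 \ {0} :=
      sdiff_subset_sdiff_left (ball_subset_ball (by linarith))
    -- Open mapping theorem; the locally constant alternative contradicts injectivity.
    rcases (hGd.analyticAt (hU.mem_nhds (hsub hz))).eventually_constant_or_nhds_le_map_nhds with h | h
    · exfalso
      have h1 : ∀ᶠ w in 𝓝[≠] z, w ∈ ({z} : Set ℂ) := by
        filter_upwards [h.filter_mono nhdsWithin_le_nhds, mem_nhdsWithin_of_mem_nhds hV] with w hw hwV
        exact hinj (hsub hwV) (hsub hz) hw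
      obtain ⟨w, hw, hw'⟩ := (h1.and self_mem_nhdsWithin).exists
      exact hw' hw
    · exact h (image_mem_map hV)
  have hsubset : G '' {z : ℂ | ρ < ‖z‖ ∧ ‖z‖ < r} ⊆ subMulConj b ⁻¹' closedBall 0 R := by
    rintro _ ⟨z, ⟨hz1, hz2⟩, rfl⟩
    rw [mem_preimage, mem_closedBall_zero_iff]
    refine norm_le_of_injOn_of_pole (H := fun z => subMulConj b (G z)) hρ (by linarith)
      ((subMulConj b).continuous.comp_continuousOn hGd.continuousOn)
      (hSinj.comp_injOn hinj) hopen ?_ hcirc hz1 (hz2.trans_le hr)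
    exact tendsto_atTop_mono (fun z => hSn (G z)) (hpoleG.const_mul_atTop (by norm_num))
  refine (measure_mono hsubset).trans ?_
  rw [volume_preimage_subMulConj (by linarith) hR0, mul_div_assoc]
  refine ENNReal.ofReal_le_ofReal (mul_le_mul_of_nonneg_left ?_ Real.pi_pos.le)
  have hpos : 0 < 1 - ‖b‖ ^ 2 := by linarith
  -- Dividing by the determinant leaves a main term at most 1/ρ² and an error that tends to 0 with
  -- ρ.
  have e : R ^ 2 / (1 - ‖b‖ ^ 2) = (1 - ‖b‖ ^ 2) / ρ ^ 2 + (4 * C * ρ ^ 2 +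
      4 * C ^ 2 * ρ ^ 6 / (1 - ‖b‖ ^ 2)) := by
    rw [hR]
    field_simp
    ring
  rw [e]
  refine add_le_add ?_ (add_le_add le_rfl ?_)
  · gcongr
    nlinarith [norm_nonneg b]
  · rw [div_le_iff₀ hpos]
    have : 0 ≤ C ^ 2 * ρ ^ 6 := by positivity
    nlinarith

open Metric Set Filter Topology MeasureTheory in
/-- The area of the image of an annulus, bounded from below by Taylor coefficients. -/
theorem le_volume_image_annulus {k : ℂ → ℂ} (hk : DifferentiableOn ℂ k (ball 0 1))
    (hk0 : k 0 = 1) (hinj : InjOn (fun z => k (z ^ 2) / z) (ball 0 1 \ {0}))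
    {P : ℝ → ℝ} (hP : ∀ s, P s = ‖taylorCoeff k 1‖ ^ 2 * s ^ 2 + 3 * ‖taylorCoeff k 2‖ ^ 2 * s ^ 6 +
      5 * ‖taylorCoeff k 3‖ ^ 2 * s ^ 10 + 7 * ‖taylorCoeff k 4‖ ^ 2 * s ^ 14)
    {ρ r : ℝ} (hρ : 0 < ρ) (hρr : ρ ≤ r) (hr : r < 1) :
    ENNReal.ofReal (Real.pi * ((P r - 1 / r ^ 2) - (P ρ - 1 / ρ ^ 2))) ≤
      volume ((fun z => k (z ^ 2) / z) '' {z : ℂ | ρ < ‖z‖ ∧ ‖z‖ < r}) := by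
  have hball : ball (0 : ℂ) 1 ∈ 𝓝 0 := ball_mem_nhds _ one_pos
  have hka := hk.analyticAt hball
  set A : Set ℂ := {z : ℂ | ρ < ‖z‖ ∧ ‖z‖ < r} with hA
  set u : ℂ → ℂ := fun w => w * (2 * deriv k w) - k w with hu
  have hud : DifferentiableOn ℂ u (ball 0 1) :=
    (differentiableOn_id.mul ((hk.deriv isOpen_ball).const_mul 2)).sub hk
  have hAm : MeasurableSet A := by
    refine IsOpen.measurableSet ?_
    exact (isOpen_lt continuous_const continuous_norm).inter
      (isOpen_lt continuous_norm continuous_const)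
  have hAsub : A ⊆ ball 0 1 \ {0} := by
    rintro z ⟨h1, h2⟩
    refine ⟨by simpa using h2.trans hr, norm_pos_iff.1 (hρ.trans h1)⟩
  have hder (z : ℂ) (hz : z ∈ A) : HasDerivAt (fun z => k (z ^ 2) / z) (u (z ^ 2) / z ^ 2) z :=
    hasDerivAt_comp_sq_div hk (mem_ball_zero_iff.1 (hAsub hz).1) (hAsub hz).2
  -- The real Jacobian of multiplication by a is |a|², so the area of the injective image is ∫|G'|².
  have hdet (a : ℂ) : |((ContinuousLinearMap.toSpanSingleton ℂ a).restrictScalars ℝ).det| =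
      ‖a‖ ^ 2 := by
    rw [ContinuousLinearMap.det, ← LinearMap.det_toMatrix Complex.basisOneI, Matrix.det_fin_two]
    simp [LinearMap.toMatrix_apply, Complex.sq_norm, Complex.normSq_apply]
    exact add_nonneg (mul_self_nonneg _) (mul_self_nonneg _)
  rw [← lintegral_abs_det_fderiv_eq_addHaar_image volume hAm
    (fun z hz => ((hder z hz).hasFDerivAt.restrictScalars ℝ).hasFDerivWithinAt)
    (hinj.mono hAsub)]
  simp only [hdet]
  -- This is 2πs · s⁻⁴ · Σ (2n - 1)² |kₙ|² s⁴ⁿ over n ≤ 4; the term n = 0, where k₀ = 1, gives 2/s³.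
  set m : ℝ → ℝ := fun s => Real.pi * (2 / s ^ 3 + 2 * ‖taylorCoeff k 1‖ ^ 2 * s +
    18 * ‖taylorCoeff k 2‖ ^ 2 * s ^ 5 + 50 * ‖taylorCoeff k 3‖ ^ 2 * s ^ 9 +
    98 * ‖taylorCoeff k 4‖ ^ 2 * s ^ 13) with hm
  have hmc : ContinuousOn m (Icc ρ r) := by
    refine continuousOn_const.mul ?_
    refine ContinuousOn.add (ContinuousOn.add (ContinuousOn.add (ContinuousOn.add ?_ ?_) ?_) ?_) ?_
    · exact continuousOn_const.div (by fun_prop) fun s hs => by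
        have := hρ.trans_le hs.1
        positivity
    all_goals fun_prop
  have hint : ∫ s in ρ..r, m s = Real.pi * ((P r - 1 / r ^ 2) - (P ρ - 1 / ρ ^ 2)) := by
    rw [intervalIntegral.integral_eq_sub_of_hasDerivAt
      (f := fun s => Real.pi * (P s - 1 / s ^ 2)) (f' := m), ← mul_sub]
    · intro s hs
      rw [uIcc_of_le hρr] at hs
      have hs0 : s ≠ 0 := (hρ.trans_le hs.1).ne'
      have h1 : HasDerivAt (fun s : ℝ => 1 / s ^ 2) (-(2 / s ^ 3)) s := by
        simp only [one_div]
        refine ((hasDerivAt_pow 2 s).inv (pow_ne_zero 2 hs0)).congr_deriv ?_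
        simp only [Nat.cast_ofNat]
        field_simp
        simp
      have h2 : HasDerivAt P (2 * ‖taylorCoeff k 1‖ ^ 2 * s + 18 * ‖taylorCoeff k 2‖ ^ 2 * s ^ 5 +
          50 * ‖taylorCoeff k 3‖ ^ 2 * s ^ 9 + 98 * ‖taylorCoeff k 4‖ ^ 2 * s ^ 13) s := by
        rw [funext hP]
        refine ((((hasDerivAt_pow 2 s).const_mul _).add ((hasDerivAt_pow 6 s).const_mul _)).add
          ((hasDerivAt_pow 10 s).const_mul _)).add ((hasDerivAt_pow 14 s).const_mul _)
          |>.congr_deriv ?_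
        norm_num
        ring
      refine ((h2.sub h1).const_mul Real.pi).congr_deriv ?_
      rw [hm]
      ring
    · exact hmc.intervalIntegrable_of_Icc hρr
  rw [← hint]
  refine ofReal_integral_le_lintegral_annulus hρ hρr ?_ (fun z => by positivity) hmc ?_ ?_
  · refine ContinuousOn.pow (ContinuousOn.norm (ContinuousOn.div ?_ (by fun_prop) ?_)) 2
    · refine hud.continuousOn.comp (by fun_prop) fun z hz => ?_
      have := mem_ball_zero_iff.1 (hAsub hz).1
      rw [mem_ball_zero_iff, norm_pow]
      nlinarith [norm_nonneg z]
    · exact fun z hz => pow_ne_zero 2 (hAsub hz).2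
  · intro s hs
    have := hρ.trans hs.1
    positivity
  · intro s hs
    have hs0 := hρ.trans hs.1
    have h1 := sum_taylorCoeff_le_circleAverage_comp_sq hs0.le (hs.2.trans hr) 5 hud
    have h2 : Real.circleAverage (fun z => ‖u (z ^ 2) / z ^ 2‖ ^ 2) 0 s =
        (s ^ 4)⁻¹ * Real.circleAverage (fun z => ‖u (z ^ 2)‖ ^ 2) 0 s := by
      rw [← smul_eq_mul, ← Real.circleAverage_fun_smul]
      refine Real.circleAverage_congr_sphere fun z hz => ?_
      have : ‖z‖ = s := by simpa [abs_of_nonneg hs0.le] using hz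
      simp only [norm_div, norm_pow, this, smul_eq_mul]
      field_simp
    rw [h2]
    refine le_trans (le_of_eq ?_) (mul_le_mul_of_nonneg_left
      (mul_le_mul_of_nonneg_left h1 (by positivity)) (by positivity))
    have hn (n : ℕ) : ‖taylorCoeff u n‖ ^ 2 = (2 * n - 1) ^ 2 * ‖taylorCoeff k n‖ ^ 2 := by
      rw [hu, taylorCoeff_two_mul_deriv_sub hka, norm_mul, mul_pow]
      congr 1
      rw [show (2 * n - 1 : ℂ) = ((2 * n - 1 : ℝ) : ℂ) by push_cast; rfl, Complex.norm_real,
        Real.norm_eq_abs, sq_abs]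
    simp only [hn, Finset.sum_range_succ, Finset.sum_range_zero, taylorCoeff_zero, hk0, hm]
    norm_num
    field_simp
    ring

open Metric Set Filter Topology in
/-- **Gronwall's area theorem**, truncated, for the odd function `z ↦ k (z ^ 2) / z`. -/
theorem area_theorem_odd {k : ℂ → ℂ} (hk : DifferentiableOn ℂ k (ball 0 1))
    (hk0 : k 0 = 1) (hinj : InjOn (fun z => k (z ^ 2) / z) (ball 0 1 \ {0})) :
    ‖taylorCoeff k 1‖ ^ 2 + 3 * ‖taylorCoeff k 2‖ ^ 2 + 5 * ‖taylorCoeff k 3‖ ^ 2 +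
      7 * ‖taylorCoeff k 4‖ ^ 2 ≤ 1 := by
  set P : ℝ → ℝ := fun s => ‖taylorCoeff k 1‖ ^ 2 * s ^ 2 + 3 * ‖taylorCoeff k 2‖ ^ 2 * s ^ 6 +
      5 * ‖taylorCoeff k 3‖ ^ 2 * s ^ 10 + 7 * ‖taylorCoeff k 4‖ ^ 2 * s ^ 14 with hP
  have hPc : Continuous P := by fun_prop
  obtain ⟨C, hC0, hC⟩ := exists_volume_image_annulus_le hk hk0 hinj
  -- In the comparison of the two area bounds the divergent terms 1/ρ² cancel, and all other terms
  -- in ρ tend to 0.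
  have hle : ∀ r : ℝ, 0 < r → r < 1 → P r ≤ 1 / r ^ 2 := by
    intro r hr0 hr1
    have hlim : Tendsto (fun ρ : ℝ => 1 / r ^ 2 + P ρ + (4 * C * ρ ^ 2 + 8 * C ^ 2 * ρ ^ 6))
        (𝓝[>] 0) (𝓝 (1 / r ^ 2)) := by
      have : Continuous fun ρ : ℝ => 1 / r ^ 2 + P ρ + (4 * C * ρ ^ 2 + 8 * C ^ 2 * ρ ^ 6) := by
        fun_prop
      simpa [hP] using (this.tendsto 0).mono_left nhdsWithin_le_nhds
    refine ge_of_tendsto hlim ?_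
    filter_upwards [hC, self_mem_nhdsWithin,
      (eventually_lt_nhds hr0).filter_mono nhdsWithin_le_nhds] with ρ h hρ hρr
    rw [mem_Ioi] at hρ
    have h1 := (le_volume_image_annulus hk hk0 hinj (fun s => rfl) hρ hρr.le hr1).trans
      (h r hr1.le)
    rw [ENNReal.ofReal_le_ofReal_iff (by positivity)] at h1
    have h2 := le_of_mul_le_mul_left h1 Real.pi_pos
    simp only [hP] at h2 ⊢
    linarith
  have h1 : Tendsto P (𝓝[<] 1) (𝓝 (P 1)) := (hPc.tendsto 1).mono_left nhdsWithin_le_nhds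
  have h2 : Tendsto (fun r : ℝ => 1 / r ^ 2) (𝓝[<] 1) (𝓝 1) := by
    have : ContinuousAt (fun r : ℝ => 1 / r ^ 2) 1 := by fun_prop (disch := norm_num)
    simpa using this.tendsto.mono_left nhdsWithin_le_nhds
  have h3 := le_of_tendsto_of_tendsto h1 h2 (by
    filter_upwards [self_mem_nhdsWithin,
      (eventually_gt_nhds (zero_lt_one' ℝ)).filter_mono nhdsWithin_le_nhds] with r hr hr0
    exact hle r hr0 hr)
  simpa [hP] using h3

/-! ### The square root transform and the conclusion. -/

open Metric Set Filter Topology in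
/-- A zero-free analytic function on the unit disc with value `1` at the origin has an analytic
inverse square root. -/
theorem exists_inv_sqrt_on_ball {h : ℂ → ℂ} (hd : DifferentiableOn ℂ h (ball 0 1))
    (hne : ∀ z ∈ ball (0 : ℂ) 1, h z ≠ 0) (h0 : h 0 = 1) :
    ∃ k : ℂ → ℂ, DifferentiableOn ℂ k (ball 0 1) ∧ k 0 = 1 ∧
      ∀ z ∈ ball (0 : ℂ) 1, h z * (k z * k z) = 1 := by
  have hld : DifferentiableOn ℂ (fun z => deriv h z / h z) (ball 0 1) :=
    (hd.deriv isOpen_ball).div hd hne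
  -- L is the primitive of h'/h with L(0) = 0, a logarithm of h: the product h · exp(-L) has zero
  -- derivative on the disc. So exp(-L/2) is the inverse square root.
  obtain ⟨L, hL0, hL⟩ := hld.isExactOn_ball.with_val_at 0 0
  refine ⟨fun z => Complex.exp (-(L z / 2)), fun z hz => ?_, by simp [hL0], fun z hz => ?_⟩
  · exact ((hL z hz).differentiableAt.div_const 2).neg.cexp.differentiableWithinAt
  · rw [← Complex.exp_add, show -(L z / 2) + -(L z / 2) = -L z by ring]
    have hder : ∀ w ∈ ball (0 : ℂ) 1, HasDerivAt (fun w => h w * Complex.exp (-L w)) 0 w := by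
      intro w hw
      have h1 := (hd.differentiableAt (isOpen_ball.mem_nhds hw)).hasDerivAt
      refine (h1.mul (hL w hw).neg.cexp).congr_deriv ?_
      have := hne w hw
      field_simp
      ring
    have hconst := (convex_ball (0 : ℂ) 1).is_const_of_fderivWithin_eq_zero (𝕜 := ℂ)
      (fun w hw => (hder w hw).differentiableAt.differentiableWithinAt)
      (fun w hw => by
        rw [fderivWithin_of_isOpen isOpen_ball hw, (hder w hw).hasFDerivAt.fderiv]
        simp) hz (mem_ball_self one_pos)
    simpa [hL0, h0] using hconst

open Metric Set Filter Topology in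
/-- For `f` in the class `S` there is an analytic branch `k` of `√(z / f z)`, and
`z ↦ k (z ^ 2) / z = 1 / √(f (z ^ 2))` is univalent in the punctured disc. -/
theorem IsClassS.exists_sqrt_transform {f : ℂ → ℂ} (hf : IsClassS f) :
    ∃ k : ℂ → ℂ, DifferentiableOn ℂ k (ball 0 1) ∧ k 0 = 1 ∧
      (∀ z ∈ ball (0 : ℂ) 1, f z * (k z * k z) = z) ∧
      InjOn (fun z => k (z ^ 2) / z) (ball 0 1 \ {0}) := by
  have hball : ball (0 : ℂ) 1 ∈ 𝓝 0 := ball_mem_nhds _ one_pos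
  have hfz (z : ℂ) : f z = z * dslope f 0 z := by
    have := sub_smul_dslope f 0 z
    rw [hf.map_zero, sub_zero, sub_zero, smul_eq_mul] at this
    exact this.symm
  have hd0 : dslope f 0 0 = 1 := by rw [dslope_same, hf.deriv_zero]
  have hne : ∀ z ∈ ball (0 : ℂ) 1, dslope f 0 z ≠ 0 := by
    intro z hz h
    rcases eq_or_ne z 0 with rfl | hz0
    · rw [hd0] at h
      exact one_ne_zero h
    · refine hz0 (hf.univalent hz (mem_ball_self one_pos) ?_)
      rw [hfz z, h, mul_zero, hf.map_zero]
  obtain ⟨k, hkd, hk0, hk⟩ := exists_inv_sqrt_on_ball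
    ((Complex.differentiableOn_dslope hball).2 hf.analytic) hne hd0
  have hfk : ∀ z ∈ ball (0 : ℂ) 1, f z * (k z * k z) = z := by
    intro z hz
    rw [hfz z, mul_assoc, hk z hz, mul_one]
  refine ⟨k, hkd, hk0, hfk, ?_⟩
  rintro a ⟨ha, ha0⟩ b ⟨hb, hb0⟩ hab
  have ha0' : a ≠ 0 := ha0
  have hb0' : b ≠ 0 := hb0
  have hsq : ∀ z ∈ ball (0 : ℂ) 1, z ^ 2 ∈ ball (0 : ℂ) 1 := by
    intro z hz
    rw [mem_ball_zero_iff] at *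
    rw [norm_pow]
    nlinarith [norm_nonneg z]
  -- Since f(z²) G(z)² = 1, equal values of G force f(a²) = f(b²), hence a² = b². The numerators of
  -- G(a) and G(b) then agree and are nonzero, which excludes a = -b.
  have hinv : ∀ z ∈ ball (0 : ℂ) 1, z ≠ 0 → f (z ^ 2) * (k (z ^ 2) / z) ^ 2 = 1 := by
    intro z hz hz0
    have := hfk _ (hsq z hz)
    field_simp
    linear_combination this
  have h1 := hinv a ha ha0'
  have h2 := hinv b hb hb0'
  simp only at hab
  rw [← hab] at h2
  have hG : (k (a ^ 2) / a) ^ 2 ≠ 0 := right_ne_zero_of_mul_eq_one h1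
  have hff : f (a ^ 2) = f (b ^ 2) := mul_right_cancel₀ hG (h1.trans h2.symm)
  have hab2 := hf.univalent (hsq a ha) (hsq b hb) hff
  rw [← hab2] at hab
  have hka : k (a ^ 2) ≠ 0 := fun h => hG (by simp [h])
  field_simp at hab
  exact hab.symm

theorem theorem2 :
    ∃ M : ℝ,
      IsGreatest ((fun p : ℝ × ℝ × ℝ × ℝ => phiTwo p.1 p.2.1 p.2.2.1 p.2.2.2) '' grunskyRegion) M ∧
      (2.3297 : ℝ) ≤ M ∧ M < (2.3298 : ℝ) ∧
      ∀ f : ℂ → ℂ, IsClassS f → ‖taylorCoeff f 5‖ - ‖taylorCoeff f 4‖ ≤ M := by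
  obtain ⟨M, hM, hM1, hM2⟩ := exists_isGreatest_phiTwo
  refine ⟨M, hM, hM1, hM2, fun f hf => ?_⟩
  have hball : Metric.ball (0 : ℂ) 1 ∈ nhds 0 := Metric.ball_mem_nhds _ one_pos
  obtain ⟨k, hkd, hk0, hfk, hinj⟩ := hf.exists_sqrt_transform
  have harea := area_theorem_odd hkd hk0 hinj
  -- The `neg_neg` arguments fix p, q, r, s as the negatives of the coefficients of k.
  obtain ⟨h4, h5⟩ := taylorCoeff_eq_of_mul_sq_eq_id (hf.analytic.analyticAt hball)
    (hkd.analyticAt hball) hk0 (Filter.mem_of_superset hball hfk) (neg_neg _).symm (neg_neg _).symm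
    (neg_neg _).symm (neg_neg _).symm
  have hp : ‖-taylorCoeff k 1‖ ≤ 1 := by
    rw [norm_neg]
    nlinarith [sq_nonneg ‖taylorCoeff k 2‖, sq_nonneg ‖taylorCoeff k 3‖,
      sq_nonneg ‖taylorCoeff k 4‖, norm_nonneg (taylorCoeff k 1)]
  refine (norm_sub_norm_le_phiTwo h4 h5 hp).trans (hM.2 ⟨_, mem_grunskyRegion_of_sq_sum_le
    (norm_nonneg _) (norm_nonneg _) (norm_nonneg _) (norm_nonneg _) ?_, rfl⟩)
  simpa only [norm_neg] using harea
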